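/- On $\mathbb{R}^6$ with coordinates $(x_1,x_2,y_1,y_2,z_1,z_2)$ let $\mathcal{D}=\ker\lambda_1\cap\ker\lambda_2$, where $$\lambda_1=dz_1-y_1dx_1-y_2dx_2-\Big(\tfrac{x_2^3}{3}+x_2+2x_1\Big)dy_1,\qquad \lambda_2=dz_2-y_2dx_1-y_1dx_2 .$$ For every point $q$ of the region $\Omega=\{|x_2|<1\}$, the germ of $\mathcal{D}$ at $q$ satisfies: i) It is a corank-$2$ fat distribution germ: near $q$, $\mathcal{D}$ is a smooth distribution of rank $4$, and at every point $x$ near $q$ the quadratic form $q_{\mathcal{D}}(\psi,\psi)=(\psi\circ\mathcal{L}_x)\wedge(\psi\circ\mathcal{L}_x)\in\bigwedge^4\mathcal{D}_x^*\cong\mathbb{R}$ on $(T_x\mathbb{R}^6/\mathcal{D}_x)^*$ is definite, where $\mathcal{L}(u,v)=[u,v]\bmod\mathcal{D}$ is the curvature of $\mathcal{D}$. ii) It has the two Reeb directions $Z_1=\partial_{z_1}$, $Z_2=\partial_{z_2}$: near $q$ there are smooth $1$-forms $\mu_1,\mu_2$ with $\mathcal{D}=\ker\mu_1\cap\ker\mu_2$,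 $T\mathbb{R}^6=\mathcal{D}\oplus\langle Z_1,Z_2\rangle$, $\mu_i(Z_j)=\delta_{ij}$, $\iota_{Z_i}d\mu_j|_{\mathcal{D}}=0$ for $i,j\in\{1,2\}$, and $[Z_1,Z_2]=0$. iii) No germ diffeomorphic to it supports a complex contact structure; that is, if the germ of $\mathcal{D}'$ at $q'\in\mathbb{R}^6$ is the image of the germ of $\mathcal{D}$ at $q$ under a local diffeomorphism, then there is no smooth diffeomorphism $\Phi$ from a neighbourhood of $q'$ onto an open set of $\mathbb{C}^3$ together with a holomorphic $1$-form $\alpha$ there, $\alpha\wedge d\alpha\neq0$ everywhere, such that $\mathcal{D}'=d\Phi^{-1}(\ker\alpha)$. Moreover, the Čap–Eastwood tensor of $\mathcal{D}$ does not vanish identically on any nonempty open subset of $\Omega$. Precisely, fix any orientation of $\mathbb{R}^6$. For open $U\subseteq\Omega$ consider the smooth almost complex structures $J$ on $U$ that induce this orientation and satisfy $J(\mathcal{D})=\mathcal{D}$, $[u,v]+J[Ju,v]\in\Gamma(\mathcal{D})$ for all $u,v\in\Gamma(\mathcal{D})$, and $[u,v]+J[Ju,v]-J[u,Jv]+[Ju,Jv]\in\Gamma(\mathcal{D})$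 for all $u\in\Gamma(TU)$, $v\in\Gamma(\mathcal{D})$. Such a $J$ exists on $\Omega$; and for every nonempty open $U\subseteq\Omega$ and every such $J$ on $U$, the tensor $S(u,v)=[u,v]+J[Ju,v]\bmod\mathcal{D}$ $(u\in\Gamma(TU),\ v\in\Gamma(\mathcal{D}))$ is not identically zero on $U$. -/

import Mathlib

open scoped ContDiff Topology

noncomputable section

namespace FatContact

/-- Real six-space, with coordinates in the order `(x₁, x₂, y₁, y₂, z₁, z₂)`. -/
abbrev R6 : Type := Fin 6 → ℝ

/-- Complex three-space. -/
abbrev C3 : Type := Fin 3 → ℂ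

/-! ### Vector fields, one-forms and distributions -/

/-- A field of tangent subspaces of six-space. -/
abbrev PlaneField : Type := R6 → Submodule ℝ R6

/-- Smooth vector fields on `U`. -/
def IsVectorFieldOn (U : Set R6) (X : R6 → R6) : Prop :=
  ContDiffOn ℝ ∞ X U

/-- Smooth sections of `D` over `U`. -/
def IsSectionOn (D : PlaneField) (U : Set R6) (X : R6 → R6) : Prop :=
  IsVectorFieldOn U X ∧ ∀ x ∈ U, X x ∈ D x

/-- The Lie bracket `[X, Y]` of vector fields on six-space. -/
def bracket (X Y : R6 → R6) : R6 → R6 :=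
  VectorField.lieBracket ℝ X Y

/-- The exterior derivative of a one-form `α`, `dα(u, v) = D_u α (v) - D_v α (u)`, over the
field `𝕜` (real or complex). -/
def dForm {𝕜 E : Type*} [NontriviallyNormedField 𝕜] [NormedAddCommGroup E] [NormedSpace 𝕜 E]
    (α : E → (E →L[𝕜] 𝕜)) (x u v : E) : 𝕜 :=
  fderiv 𝕜 α x u v - fderiv 𝕜 α x v u

/-- Near `q`, the plane field `D` is a smooth distribution of rank four (corank two): it has a
smooth local frame of four vector fields. -/
def IsCorankTwoGerm (D : PlaneField) (q : R6) : Prop :=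
  ∃ U : Set R6, IsOpen U ∧ q ∈ U ∧ ∃ X : Fin 4 → R6 → R6,
    (∀ i, IsVectorFieldOn U (X i)) ∧
    ∀ x ∈ U, LinearIndependent ℝ (fun i => X i x) ∧
      D x = Submodule.span ℝ (Set.range fun i => X i x)

/-! ### Curvature and fatness -/

/-- `L` is the curvature (Levi map) of `D` at `x`:
`L (X x) (Y x) = [X, Y] x mod D x` for all smooth sections `X`, `Y` of `D` near `x`. -/
def IsCurvatureAt (D : PlaneField) (x : R6) (L : D x →ₗ[ℝ] D x →ₗ[ℝ] (R6 ⧸ D x)) : Prop :=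
  ∀ (U : Set R6) (X Y : R6 → R6) (_ : IsOpen U) (hx : x ∈ U)
    (hX : IsSectionOn D U X) (hY : IsSectionOn D U Y),
    L ⟨X x, hX.2 x hx⟩ ⟨Y x, hY.2 x hx⟩ = (D x).mkQ (bracket X Y x)

/-- The wedge product of two 2-forms, evaluated on four vectors. -/
def wedgeTwoTwo {V : Type*} (σ η : V → V → ℝ) (v : Fin 4 → V) : ℝ :=
  σ (v 0) (v 1) * η (v 2) (v 3) - σ (v 0) (v 2) * η (v 1) (v 3)
    + σ (v 0) (v 3) * η (v 1) (v 2) + σ (v 1) (v 2) * η (v 0) (v 3)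
    - σ (v 1) (v 3) * η (v 0) (v 2) + σ (v 2) (v 3) * η (v 0) (v 1)

/-- The form `q_D(ψ, φ) = (ψ ∘ L) ∧ (φ ∘ L)` on the dual of `T/D`, made real-valued by the volume
form on `D x` that takes the value `1` on the basis `b`. -/
def qForm {D : PlaneField} {x : R6} (L : D x →ₗ[ℝ] D x →ₗ[ℝ] (R6 ⧸ D x))
    (b : Module.Basis (Fin 4) ℝ (D x)) (ψ φ : Module.Dual ℝ (R6 ⧸ D x)) : ℝ :=
  wedgeTwoTwo (fun u v => ψ (L u v)) (fun u v => φ (L u v)) b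

/-- `D` is fat (elliptic) at `x`: the quadratic form `q_D` is definite. The choice of the basis
`b` only scales `q_D` by a nonzero number. -/
def IsFatAt (D : PlaneField) (x : R6) : Prop :=
  ∃ L : D x →ₗ[ℝ] D x →ₗ[ℝ] (R6 ⧸ D x), IsCurvatureAt D x L ∧
    ∃ b : Module.Basis (Fin 4) ℝ (D x),
      (∀ ψ : Module.Dual ℝ (R6 ⧸ D x), ψ ≠ 0 → 0 < qForm L b ψ ψ) ∨
      (∀ ψ : Module.Dual ℝ (R6 ⧸ D x), ψ ≠ 0 → qForm L b ψ ψ < 0)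

/-- The germ of `D` at `q` is a corank-two fat distribution germ. -/
def IsFatGerm (D : PlaneField) (q : R6) : Prop :=
  IsCorankTwoGerm D q ∧ ∀ᶠ x in 𝓝 q, IsFatAt D x

/-! ### Reeb directions -/

/-- The vector fields `Z 0`, `Z 1` are Reeb directions of the germ of `D` at `q`. -/
def AreReebDirectionsAt (D : PlaneField) (q : R6) (Z : Fin 2 → R6 → R6) : Prop :=
  ∃ U : Set R6, IsOpen U ∧ q ∈ U ∧ (∀ i, IsVectorFieldOn U (Z i)) ∧
    ∃ l : Fin 2 → R6 → (R6 →L[ℝ] ℝ), (∀ j, ContDiffOn ℝ ∞ (l j) U) ∧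
      ∀ x ∈ U,
        (∀ v, v ∈ D x ↔ l 0 x v = 0 ∧ l 1 x v = 0) ∧
        IsCompl (D x) (Submodule.span ℝ {Z 0 x, Z 1 x}) ∧
        (∀ i j, l i x (Z j x) = if i = j then 1 else 0) ∧
        (∀ i j, ∀ v ∈ D x, dForm (l j) x (Z i x) v = 0) ∧
        bracket (Z 0) (Z 1) x = 0

/-! ### Complex contact structures -/

/-- The value of the 3-form `α ∧ dα` on `(u, v, w)`. -/
def contactForm (α : C3 → (C3 →L[ℂ] ℂ)) (p u v w : C3) : ℂ :=
  α p u * dForm α p v w - α p v * dForm α p u w + α p w * dForm α p u v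

/-- `α` is a holomorphic contact form on `W`. -/
def IsHolomorphicContactOn (W : Set C3) (α : C3 → (C3 →L[ℂ] ℂ)) : Prop :=
  DifferentiableOn ℂ α W ∧ ∀ p ∈ W, ∃ u v w : C3, contactForm α p u v w ≠ 0

/-- The germ of `D` at `q` supports a complex contact structure: on a neighbourhood of `q` there
is a complex structure, given by a smooth chart `Φ` with values in complex three-space, for which
`D` is the real distribution underlying the kernel of a holomorphic contact form. -/
def SupportsComplexContact (D : PlaneField) (q : R6) : Prop :=
  ∃ (Φ : OpenPartialHomeomorph R6 C3) (α : C3 → (C3 →L[ℂ] ℂ)),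
    q ∈ Φ.source ∧ ContDiffOn ℝ ∞ Φ Φ.source ∧ ContDiffOn ℝ ∞ Φ.symm Φ.target ∧
    IsHolomorphicContactOn Φ.target α ∧
    ∀ y ∈ Φ.source, ∀ v : R6, v ∈ D y ↔ α (Φ y) (fderiv ℝ Φ y v) = 0

/-- The germs of `D` at `q` and of `D'` at `q'` are diffeomorphic. -/
def AreDiffeomorphicGerms (D : PlaneField) (q : R6) (D' : PlaneField) (q' : R6) : Prop :=
  ∃ φ : OpenPartialHomeomorph R6 R6, q ∈ φ.source ∧ φ q = q' ∧
    ContDiffOn ℝ ∞ φ φ.source ∧ ContDiffOn ℝ ∞ φ.symm φ.target ∧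
    ∀ y ∈ φ.source, (D y).map (fderiv ℝ φ y : R6 →ₗ[ℝ] R6) = D' (φ y)

/-! ### The Čap–Eastwood almost complex structure and tensor -/

/-- The vector field `J u`. -/
def applyJ (J : R6 → (R6 →L[ℝ] R6)) (u : R6 → R6) : R6 → R6 := fun x => J x (u x)

/-- `J` is an almost complex structure on `U` with the properties that characterise the
Čap–Eastwood structure of the fat distribution `D` on `U`, oriented by `o`. -/
structure IsCapEastwood (o : Orientation ℝ R6 (Fin 6)) (D : PlaneField) (U : Set R6)
    (J : R6 → (R6 →L[ℝ] R6)) : Prop where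
  smooth : ContDiffOn ℝ ∞ J U
  sq : ∀ x ∈ U, ∀ v, J x (J x v) = -v
  map_eq : ∀ x ∈ U, (D x).map (J x : R6 →ₗ[ℝ] R6) = D x
  orientation : ∀ x ∈ U, ∀ b : Module.Basis (Fin 6) ℝ R6,
    b 1 = J x (b 0) → b 3 = J x (b 2) → b 5 = J x (b 4) → b.orientation = o
  curvature : ∀ u v, IsSectionOn D U u → IsSectionOn D U v → ∀ x ∈ U,
    bracket u v x + J x (bracket (applyJ J u) v x) ∈ D x
  compat : ∀ u v, IsVectorFieldOn U u → IsSectionOn D U v → ∀ x ∈ U,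
    bracket u v x + J x (bracket (applyJ J u) v x) - J x (bracket u (applyJ J v) x)
      + bracket (applyJ J u) (applyJ J v) x ∈ D x

/-- The Čap–Eastwood tensor `S(u, v) = [u, v] + J [J u, v] mod D`. -/
def tensorS (D : PlaneField) (J : R6 → (R6 →L[ℝ] R6)) (u v : R6 → R6) (x : R6) : R6 ⧸ D x :=
  (D x).mkQ (bracket u v x + J x (bracket (applyJ J u) v x))

/-- The tensor `S` does not vanish identically on `U`. -/
def TensorSNonzeroOn (D : PlaneField) (J : R6 → (R6 →L[ℝ] R6)) (U : Set R6) : Prop :=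
  ∃ u v, IsVectorFieldOn U u ∧ IsSectionOn D U v ∧ ∃ x ∈ U, tensorS D J u v x ≠ 0

/-! ### The distribution -/

/-- The coordinate one-forms `dx₁, dx₂, dy₁, dy₂, dz₁, dz₂`. -/
def dc (i : Fin 6) : R6 →L[ℝ] ℝ := ContinuousLinearMap.proj i

/-- `λ₁ = dz₁ - y₁ dx₁ - y₂ dx₂ - (x₂³/3 + x₂ + 2 x₁) dy₁`. -/
def lam1 (q : R6) : R6 →L[ℝ] ℝ :=
  dc 4 - q 2 • dc 0 - q 3 • dc 1 - ((q 1) ^ 3 / 3 + q 1 + 2 * q 0) • dc 2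

/-- `λ₂ = dz₂ - y₂ dx₁ - y₁ dx₂`. -/
def lam2 (q : R6) : R6 →L[ℝ] ℝ :=
  dc 5 - q 3 • dc 0 - q 2 • dc 1

/-- The distribution `D = ker λ₁ ∩ ker λ₂`. -/
def distD : PlaneField := fun q =>
  LinearMap.ker (lam1 q : R6 →ₗ[ℝ] ℝ) ⊓ LinearMap.ker (lam2 q : R6 →ₗ[ℝ] ℝ)

/-- The constant coordinate vector fields `∂_{z₁}` and `∂_{z₂}`. -/
def dz : Fin 2 → R6 → R6 := ![fun _ => Pi.single 4 1, fun _ => Pi.single 5 1]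

/-- The region `|x₂| < 1`. -/
def region : Set R6 := {q | |q 1| < 1}

end FatContact

end

open scoped ContDiff Topology

noncomputable section

namespace FatContact

/-! On `distD` the form `a λ₁ + b λ₂` has differential with square a positive multiple of `a² - (1 +
x₂²) a b + b²`, which is definite exactly when `x₂² < 1`: this is fatness. The forms `λ₁, λ₂` have
coefficients free of `z₁, z₂`, so `∂_{z₁}, ∂_{z₂}` are commuting Reeb fields.

The obstruction to a complex contact structure and the nonvanishing of `S` are one statement,
`false_of_complex_form`. A contact form pulled back by a chart, or `λ₁ - i λ₁ ∘ J` when `S = 0`, is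
a complex form `β = g λ₁ + h λ₂` with `β ∘ J = i β` and `dβ(w + iJw, v) = 0` for `v` in `distD`. Put
`s = 1 + x₂²`. Taking `w` in `distD` makes `g dλ₁ + h dλ₂` degenerate there, so `g² - s g h + h² =
0`, and the complex vector `ξ = g X₂ + (h - s g) X₁` is null for it, where `X₁, X₂` lift `∂_{x₁},
∂_{x₂}`. Taking `w = ∂_{z₁}` and `v = ξ` then gives `ξ(h/g) = 0`. But `h/g` is a root of `τ² - s τ +
1`, and differentiating this equation along `ξ`, whose `∂_{x₂}` component is `g ≠ 0`, forces `x₂ =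
0`. Points with `x₂ ≠ 0` are dense, so no open set carries such a `β`.

Existence of `J` is explicit: `theJ` makes `λ₁ + τ λ₂` of type `(1, 0)`, for the root `τ = p + i r`
with `r > 0`. Both remaining axioms become identities for the differential of this form
(`lamC_tensor`). Replacing `J` by `-J` handles the other orientation. -/

/-- The lifts to `distD` of the coordinate fields `∂_{x₁}, ∂_{x₂}, ∂_{y₁}, ∂_{y₂}`. -/
def frame (i : Fin 4) (q : R6) : R6 :=
  (![![1, 0, 0, 0, q 2, q 3], ![0, 1, 0, 0, q 3, q 2],
    ![0, 0, 1, 0, (q 1) ^ 3 / 3 + q 1 + 2 * q 0, 0], ![0, 0, 0, 1, 0, 0]] :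
      Fin 4 → Fin 6 → ℝ) i

theorem lam1_apply (q v : R6) :
    lam1 q v = v 4 - q 2 * v 0 - q 3 * v 1 - ((q 1) ^ 3 / 3 + q 1 + 2 * q 0) * v 2 := by
  simp [lam1, dc]

theorem lam2_apply (q v : R6) : lam2 q v = v 5 - q 3 * v 0 - q 2 * v 1 := by
  simp [lam2, dc]

theorem mem_distD {q v : R6} : v ∈ distD q ↔ lam1 q v = 0 ∧ lam2 q v = 0 := by
  simp [distD]

theorem contDiff_coord (i : Fin 6) : ContDiff ℝ ∞ (fun q : R6 => q i) :=
  contDiff_apply ℝ ℝ i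

theorem contDiff_dc_smul {f : R6 → ℝ} (hf : ContDiff ℝ ∞ f) (i : Fin 6) :
    ContDiff ℝ ∞ (fun q => f q • dc i) :=
  hf.smul contDiff_const

theorem contDiff_lam1 : ContDiff ℝ ∞ lam1 := by
  have h0 := contDiff_coord 0
  have h1 := contDiff_coord 1
  refine ((contDiff_const.sub (contDiff_dc_smul (contDiff_coord 2) 0)).sub
    (contDiff_dc_smul (contDiff_coord 3) 1)).sub (contDiff_dc_smul ?_ 2)
  exact (((h1.pow 3).div_const _).add h1).add (contDiff_const.mul h0)

theorem contDiff_lam2 : ContDiff ℝ ∞ lam2 :=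
  (contDiff_const.sub (contDiff_dc_smul (contDiff_coord 3) 0)).sub
    (contDiff_dc_smul (contDiff_coord 2) 1)

theorem contDiff_frame (i : Fin 4) : ContDiff ℝ ∞ (frame i) := by
  have h0 := contDiff_coord 0
  have h1 := contDiff_coord 1
  have h2 := contDiff_coord 2
  have h3 := contDiff_coord 3
  rw [contDiff_pi]
  intro j
  fin_cases i <;> fin_cases j <;> simp [frame] <;> fun_prop

theorem frame_mem (i : Fin 4) (q : R6) : frame i q ∈ distD q := by
  rw [mem_distD, lam1_apply, lam2_apply]
  fin_cases i <;> simp [frame]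

theorem eq_sum_frame {q v : R6} (hv : v ∈ distD q) :
    v = v 0 • frame 0 q + v 1 • frame 1 q + v 2 • frame 2 q + v 3 • frame 3 q := by
  rw [mem_distD, lam1_apply, lam2_apply] at hv
  obtain ⟨h1, h2⟩ := hv
  ext j
  fin_cases j <;> simp [frame] <;> linarith

theorem linearIndependent_frame (q : R6) : LinearIndependent ℝ (fun i => frame i q) := by
  rw [Fintype.linearIndependent_iff]
  intro c hc
  simp only [Fin.sum_univ_four] at hc
  have h (j : Fin 6) := congrFun hc j
  have h0 := h 0
  have h1 := h 1
  have h2 := h 2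
  have h3 := h 3
  simp [frame] at h0 h1 h2 h3
  intro i
  fin_cases i <;> simpa

theorem distD_eq_span (q : R6) :
    distD q = Submodule.span ℝ (Set.range fun i => frame i q) := by
  apply le_antisymm
  · intro v hv
    have key (i : Fin 4) (c : ℝ) :
        c • frame i q ∈ Submodule.span ℝ (Set.range fun i => frame i q) :=
      Submodule.smul_mem _ _ (Submodule.subset_span ⟨i, rfl⟩)
    rw [eq_sum_frame hv]
    exact add_mem (add_mem (add_mem (key _ _) (key _ _)) (key _ _)) (key _ _)
  · rw [Submodule.span_le]
    rintro _ ⟨i, rfl⟩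
    exact frame_mem i q

theorem isOpen_region : IsOpen region :=
  isOpen_lt (by fun_prop) continuous_const

theorem isCorankTwoGerm_distD (q : R6) : IsCorankTwoGerm distD q :=
  ⟨Set.univ, isOpen_univ, trivial, frame, fun i => (contDiff_frame i).contDiffOn,
    fun x _ => ⟨linearIndependent_frame x, distD_eq_span x⟩⟩

/-! ### Exterior derivatives -/

/-- The exterior derivative of a one-form with values in a real normed space. -/
def extDer {F : Type*} [NormedAddCommGroup F] [NormedSpace ℝ F]
    (β : R6 → (R6 →L[ℝ] F)) (x u v : R6) : F :=
  fderiv ℝ β x u v - fderiv ℝ β x v u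

/-- Cartan's formula. -/
theorem apply_bracket {F : Type*} [NormedAddCommGroup F] [NormedSpace ℝ F]
    {β : R6 → (R6 →L[ℝ] F)} {x : R6} {u v : R6 → R6} (hβ : DifferentiableAt ℝ β x)
    (hu : DifferentiableAt ℝ u x) (hv : DifferentiableAt ℝ v x) :
    β x (bracket u v x) = fderiv ℝ (fun y => β y (v y)) x (u x)
      - fderiv ℝ (fun y => β y (u y)) x (v x) - extDer β x (u x) (v x) := by
  rw [fderiv_clm_apply hβ hv, fderiv_clm_apply hβ hu]
  simp [bracket, VectorField.lieBracket, extDer]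
  abel

/-- `dλ₁` on `(u, v)`. -/
def om1 (x u v : R6) : ℝ :=
  -(u 0 * v 2 - u 2 * v 0) + (u 1 * v 3 - u 3 * v 1)
    - (1 + (x 1) ^ 2) * (u 1 * v 2 - u 2 * v 1)

/-- `dλ₂` on `(u, v)`. -/
def om2 (u v : R6) : ℝ :=
  (u 0 * v 3 - u 3 * v 0) + (u 1 * v 2 - u 2 * v 1)

theorem fderiv_apply_const {F : Type*} [NormedAddCommGroup F] [NormedSpace ℝ F]
    {β : R6 → (R6 →L[ℝ] F)} {x : R6} (hβ : DifferentiableAt ℝ β x) (u v : R6) :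
    fderiv ℝ β x u v = fderiv ℝ (fun y => β y v) x u := by
  rw [fderiv_clm_apply hβ (differentiableAt_const v)]
  simp

theorem fderiv_lam1 (x u v : R6) :
    fderiv ℝ lam1 x u v = - u 2 * v 0 - u 3 * v 1 - ((1 + (x 1) ^ 2) * u 1 + 2 * u 0) * v 2 := by
  rw [fderiv_apply_const (contDiff_lam1.differentiable (by simp) x)]
  simp only [lam1_apply]
  have h (i : Fin 6) : HasFDerivAt (fun q : R6 => q i) (dc i) x := hasFDerivAt_apply i x
  have := ((((h 2).mul_const (v 0)).const_sub (v 4)).sub ((h 3).mul_const (v 1))).sub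
    ((((((h 1).pow 3).mul_const (3 : ℝ)⁻¹).add (h 1)).add ((h 0).const_mul 2)).mul_const (v 2))
  simp only [div_eq_mul_inv]
  erw [this.fderiv]
  simp [dc]
  ring

theorem fderiv_lam2 (x u v : R6) :
    fderiv ℝ lam2 x u v = - u 3 * v 0 - u 2 * v 1 := by
  rw [fderiv_apply_const (contDiff_lam2.differentiable (by simp) x)]
  simp only [lam2_apply]
  have h (i : Fin 6) : HasFDerivAt (fun q : R6 => q i) (dc i) x := hasFDerivAt_apply i x
  have := (((h 3).mul_const (v 0)).const_sub (v 5)).sub ((h 2).mul_const (v 1))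
  erw [this.fderiv]
  simp [dc]
  ring

theorem extDer_lam1 (x u v : R6) : extDer lam1 x u v = om1 x u v := by
  simp only [extDer, fderiv_lam1, om1]; ring

theorem extDer_lam2 (x u v : R6) : extDer lam2 x u v = om2 u v := by
  simp only [extDer, fderiv_lam2, om2]; ring

theorem areReebDirectionsAt_distD (q : R6) : AreReebDirectionsAt distD q dz := by
  have hl (i j : Fin 2) (x : R6) : (![lam1, lam2] i) x (dz j x) = if i = j then 1 else 0 := by
    fin_cases i <;> fin_cases j <;> simp [lam1_apply, lam2_apply, dz]
  refine ⟨Set.univ, isOpen_univ, trivial, fun i => ?_, ![lam1, lam2], fun j => ?_,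
    fun x _ => ⟨fun v => mem_distD, ?_, fun i j => hl i j x, fun i j v _ => ?_, ?_⟩⟩
  · fin_cases i <;> exact contDiffOn_const
  · fin_cases j
    · exact contDiff_lam1.contDiffOn
    · exact contDiff_lam2.contDiffOn
  · have h00 := hl 0 0 x
    have h01 := hl 0 1 x
    have h10 := hl 1 0 x
    have h11 := hl 1 1 x
    simp only [Matrix.cons_val_zero, Matrix.cons_val_one, if_true] at h00 h01 h10 h11
    norm_num at h01 h10
    constructor
    · rw [Submodule.disjoint_def]
      intro v hv hv'
      obtain ⟨a, b, rfl⟩ := Submodule.mem_span_pair.1 hv'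
      rw [mem_distD] at hv
      simp [h00, h01, h10, h11] at hv
      simp [hv]
    · rw [codisjoint_iff, eq_top_iff]
      intro v _
      rw [Submodule.mem_sup]
      refine ⟨v - (lam1 x v • dz 0 x + lam2 x v • dz 1 x), ?_, _,
        Submodule.mem_span_pair.2 ⟨lam1 x v, lam2 x v, rfl⟩, by simp⟩
      rw [mem_distD]
      simp [h00, h01, h10, h11]
  · change extDer (![lam1, lam2] j) x (dz i x) v = 0
    fin_cases j
    · change extDer lam1 x _ v = 0
      rw [extDer_lam1]
      fin_cases i <;> simp [om1, dz]
    · change extDer lam2 x _ v = 0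
      rw [extDer_lam2]
      fin_cases i <;> simp [om2, dz]
  · simp [bracket, VectorField.lieBracket, dz]

/-! ### Fatness -/

theorem fderiv_apply_section {l : R6 → (R6 →L[ℝ] ℝ)} {U : Set R6} {X : R6 → R6} {x : R6}
    (hU : IsOpen U) (hx : x ∈ U) (h : ∀ y ∈ U, l y (X y) = 0) :
    fderiv ℝ (fun y => l y (X y)) x = 0 := by
  have : (fun y => l y (X y)) =ᶠ[𝓝 x] fun _ => 0 :=
    Filter.eventually_of_mem (hU.mem_nhds hx) h
  rw [this.fderiv_eq]; simp

/-- The curvature of `distD`. -/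
def curv (x : R6) : distD x →ₗ[ℝ] distD x →ₗ[ℝ] (R6 ⧸ distD x) :=
  LinearMap.mk₂ ℝ (fun u v => (distD x).mkQ
      (-(om1 x u v • dz 0 x + om2 u v • dz 1 x)))
    (fun a b c => by rw [← map_add]; congr 1; simp [om1, om2]; module)
    (fun a b c => by rw [← map_smul]; congr 1; simp [om1, om2]; module)
    (fun a b c => by rw [← map_add]; congr 1; simp [om1, om2]; module)
    (fun a b c => by rw [← map_smul]; congr 1; simp [om1, om2]; module)

/-- Cartan's formula on sections leaves `λⱼ([X, Y]) = -dλⱼ(X, Y)`, and the classes of `∂_{z₁},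
∂_{z₂}` form the basis of the quotient dual to `λ₁, λ₂`. -/
theorem isCurvatureAt_curv (x : R6) : IsCurvatureAt distD x (curv x) := by
  intro U X Y hU hx hX hY
  have hXd := (hX.1.contDiffAt (hU.mem_nhds hx)).differentiableAt (by simp)
  have hYd := (hY.1.contDiffAt (hU.mem_nhds hx)).differentiableAt (by simp)
  have h1 := apply_bracket (contDiff_lam1.differentiable (by simp) x) hXd hYd
  have h2 := apply_bracket (contDiff_lam2.differentiable (by simp) x) hXd hYd
  rw [fderiv_apply_section hU hx fun y hy => (mem_distD.1 (hX.2 y hy)).1,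
    fderiv_apply_section hU hx fun y hy => (mem_distD.1 (hY.2 y hy)).1, extDer_lam1] at h1
  rw [fderiv_apply_section hU hx fun y hy => (mem_distD.1 (hX.2 y hy)).2,
    fderiv_apply_section hU hx fun y hy => (mem_distD.1 (hY.2 y hy)).2, extDer_lam2] at h2
  simp only [curv, LinearMap.mk₂_apply, Submodule.mkQ_apply]
  rw [Submodule.Quotient.eq, mem_distD, map_sub, map_sub, h1, h2]
  simp [lam1_apply, lam2_apply, dz]

/-- The basis of `distD x` given by the frame. -/
def frameBasis (x : R6) : Module.Basis (Fin 4) ℝ (distD x) :=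
  Module.Basis.mk (v := fun i => (⟨frame i x, frame_mem i x⟩ : distD x))
    (LinearIndependent.of_comp (distD x).subtype (linearIndependent_frame x))
    (by
      rintro ⟨v, hv⟩ _
      have key (i : Fin 4) (c : ℝ) : c • (⟨frame i x, frame_mem i x⟩ : distD x) ∈
          Submodule.span ℝ (Set.range fun i => (⟨frame i x, frame_mem i x⟩ : distD x)) :=
        Submodule.smul_mem _ _ (Submodule.subset_span ⟨i, rfl⟩)
      have : (⟨v, hv⟩ : distD x) = v 0 • ⟨frame 0 x, frame_mem 0 x⟩
          + v 1 • ⟨frame 1 x, frame_mem 1 x⟩ + v 2 • ⟨frame 2 x, frame_mem 2 x⟩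
          + v 3 • ⟨frame 3 x, frame_mem 3 x⟩ := Subtype.ext (eq_sum_frame hv)
      rw [this]
      exact add_mem (add_mem (add_mem (key _ _) (key _ _)) (key _ _)) (key _ _))

theorem sq_lt_one_of_mem {x : R6} (hx : x ∈ region) : (x 1) ^ 2 < 1 :=
  (sq_lt_one_iff_abs_lt_one _).2 hx

theorem isFatAt_distD {x : R6} (hx : x ∈ region) : IsFatAt distD x := by
  refine ⟨curv x, isCurvatureAt_curv x, frameBasis x, Or.inl fun ψ hψ => ?_⟩
  obtain ⟨a, ha⟩ : ∃ a, a = ψ ((distD x).mkQ (dz 0 x)) := ⟨_, rfl⟩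
  obtain ⟨b, hb⟩ : ∃ b, b = ψ ((distD x).mkQ (dz 1 x)) := ⟨_, rfl⟩
  have hL (u v : distD x) : ψ (curv x u v) = -(om1 x u v * a + om2 u v * b) := by
    simp only [curv, LinearMap.mk₂_apply, map_neg, map_add, map_smul, ha, hb, smul_eq_mul]
  have hab : ¬ (a = 0 ∧ b = 0) := by
    rintro ⟨h0, h1⟩
    apply hψ
    refine LinearMap.ext fun w => ?_
    obtain ⟨v, rfl⟩ := (distD x).mkQ_surjective w
    have : (distD x).mkQ v = lam1 x v • (distD x).mkQ (dz 0 x)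
        + lam2 x v • (distD x).mkQ (dz 1 x) := by
      rw [← map_smul, ← map_smul, ← map_add, Submodule.mkQ_apply, Submodule.mkQ_apply,
        Submodule.Quotient.eq, mem_distD]
      simp [lam1_apply, lam2_apply, dz]
      constructor <;> ring
    rw [this, map_add, map_smul, map_smul, ← ha, ← hb, h0, h1]
    simp
  -- Since `2|ab| ≤ a² + b²`, this is positive for `(a, b) ≠ 0` as soon as `1 + x₂² < 2`.
  have hq : qForm (curv x) (frameBasis x) ψ ψ
      = 2 * (a ^ 2 + b ^ 2 - (1 + (x 1) ^ 2) * (a * b)) := by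
    simp only [qForm, wedgeTwoTwo, hL]
    simp [frameBasis, frame, om1, om2]
    ring
  rw [hq]
  have hs := sq_lt_one_of_mem hx
  have hs0 := sq_nonneg (x 1)
  have h3 : 0 < a ^ 2 + b ^ 2 := by
    by_contra h
    exact hab ⟨by nlinarith [sq_nonneg a, sq_nonneg b], by nlinarith [sq_nonneg a, sq_nonneg b]⟩
  nlinarith [sq_nonneg (a - b), sq_nonneg (a + b)]

theorem isFatGerm_distD {q : R6} (hq : q ∈ region) : IsFatGerm distD q :=
  ⟨isCorankTwoGerm_distD q,
    Filter.eventually_of_mem (isOpen_region.mem_nhds hq) fun _ => isFatAt_distD⟩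

/-! ### The common obstruction, and its application to the tensor `S` -/

open Complex in
/-- There is no complex one-form near a point with `x₂ ≠ 0` that vanishes on `distD`, is
`J`-linear, and whose exterior derivative kills `(w + iJw, v)` for all `v` in `distD`. -/
theorem false_of_complex_form {x₀ : R6} (hx₀ : x₀ 1 ≠ 0) {N : Set R6} (hN : IsOpen N)
    (hx₀N : x₀ ∈ N) {β : R6 → (R6 →L[ℝ] ℂ)} {J : R6 → R6 → R6}
    (hβ : ∀ x ∈ N, DifferentiableAt ℝ β x)
    (hJD : ∀ x ∈ N, ∀ v ∈ distD x, J x v ∈ distD x)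
    (hJ : ∀ x ∈ N, ∀ w, β x (J x w) = I * β x w)
    (h0 : ∀ x ∈ N, ∀ v ∈ distD x, β x v = 0)
    (hne : ∀ x ∈ N, β x (dz 0 x) ≠ 0)
    (hd : ∀ x ∈ N, ∀ w, ∀ v ∈ distD x,
      extDer β x w v + I * extDer β x (J x w) v = 0) : False := by
  set g : R6 → ℂ := fun x => β x (Pi.single 4 1) with hg
  set h : R6 → ℂ := fun x => β x (Pi.single 5 1) with hh
  have hgd (x) (hx : x ∈ N) : DifferentiableAt ℝ g x :=
    (hβ x hx).clm_apply (differentiableAt_const _)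
  have hhd (x) (hx : x ∈ N) : DifferentiableAt ℝ h x :=
    (hβ x hx).clm_apply (differentiableAt_const _)
  have hform (x) (hx : x ∈ N) (w : R6) : β x w = lam1 x w • g x + lam2 x w • h x := by
    have := h0 x hx (w - lam1 x w • Pi.single 4 1 - lam2 x w • Pi.single 5 1)
      (by rw [mem_distD]; simp [lam1_apply, lam2_apply]; constructor <;> ring)
    rw [map_sub, map_sub, map_smul, map_smul, sub_sub, sub_eq_zero] at this
    exact this
  have hder (x) (hx : x ∈ N) (u v : R6) : fderiv ℝ β x u v =
      lam1 x v • fderiv ℝ g x u + fderiv ℝ lam1 x u v • g x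
      + (lam2 x v • fderiv ℝ h x u + fderiv ℝ lam2 x u v • h x) := by
    have h1 : DifferentiableAt ℝ (fun y => lam1 y v) x :=
      (contDiff_lam1.differentiable (by simp) x).clm_apply (differentiableAt_const _)
    have h2 : DifferentiableAt ℝ (fun y => lam2 y v) x :=
      (contDiff_lam2.differentiable (by simp) x).clm_apply (differentiableAt_const _)
    have he : (fun y => β y v) =ᶠ[𝓝 x] fun y => lam1 y v • g y + lam2 y v • h y :=
      Filter.eventually_of_mem (hN.mem_nhds hx) fun y hy => hform y hy v
    have hF := (h1.hasFDerivAt.smul (hgd x hx).hasFDerivAt).add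
      (h2.hasFDerivAt.smul (hhd x hx).hasFDerivAt)
    rw [fderiv_apply_const (hβ x hx), (hF.congr_of_eventuallyEq he).fderiv,
      fderiv_apply_const (contDiff_lam1.differentiable (by simp) x),
      fderiv_apply_const (contDiff_lam2.differentiable (by simp) x)]
    rfl
  have hext (x) (hx : x ∈ N) (u v : R6) (hv : v ∈ distD x) : extDer β x u v =
      om1 x u v * g x + om2 u v * h x
        - lam1 x u * fderiv ℝ g x v - lam2 x u * fderiv ℝ h x v := by
    obtain ⟨hv1, hv2⟩ := mem_distD.1 hv
    rw [← extDer_lam1, ← extDer_lam2]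
    simp only [extDer, hder x hx, hv1, hv2, zero_smul, real_smul, ofReal_sub]
    ring
  -- Components of `w + iJw` with `w` and `J` real have this shape wherever `w` has component `1`.
  have hone (c : ℝ) : 1 + I * c ≠ 0 := fun hc => by simpa using congrArg re hc
  have hquad (x) (hx : x ∈ N) :
      g x ^ 2 - (1 + (x 1 : ℂ) ^ 2) * (g x * h x) + h x ^ 2 = 0 := by
    have hj := hJD x hx _ (frame_mem 0 x)
    obtain ⟨j, hjj⟩ : ∃ j, j = J x (frame 0 x) := ⟨_, rfl⟩
    have e2 := hd x hx (frame 0 x) _ (frame_mem 2 x)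
    have e3 := hd x hx (frame 0 x) _ (frame_mem 3 x)
    rw [hext x hx _ _ (frame_mem _ _), hext x hx _ _ (frame_mem _ _),
      (mem_distD.1 (frame_mem 0 x)).1, (mem_distD.1 (frame_mem 0 x)).2, (mem_distD.1 hj).1,
      (mem_distD.1 hj).2, ← hjj] at e2 e3
    simp [om1, om2, frame] at e2 e3
    -- The vector `X₁ + iJX₁` is null for `g dλ₁ + h dλ₂` on `distD`. Its pairings with the lifts of
    -- `∂_{y₁}, ∂_{y₂}` are linear in its `∂_{x₁}, ∂_{x₂}` components; eliminating the second leaves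
    -- the quadratic times `1 + i j₀`.
    refine (mul_eq_zero.1 ?_).resolve_left (hone (j 0))
    linear_combination (-g x) * e2 + (h x - (1 + (x 1 : ℂ) ^ 2) * g x) * e3
  obtain ⟨j, hj⟩ : ∃ j, j = J x₀ (dz 0 x₀) := ⟨_, rfl⟩
  have e0 := hd x₀ hx₀N (dz 0 x₀) _ (frame_mem 0 x₀)
  have e1 := hd x₀ hx₀N (dz 0 x₀) _ (frame_mem 1 x₀)
  have ek := hJ x₀ hx₀N (dz 0 x₀)
  rw [hform x₀ hx₀N, hform x₀ hx₀N, ← hj] at ek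
  rw [hext x₀ hx₀N _ _ (frame_mem _ _), hext x₀ hx₀N _ _ (frame_mem _ _), ← hj] at e0 e1
  have z1 : lam1 x₀ (dz 0 x₀) = 1 := by simp [lam1_apply, dz]
  have z2 : lam2 x₀ (dz 0 x₀) = 0 := by simp [lam2_apply, dz]
  rw [z1, z2] at e0 e1 ek
  have hq (w : R6) : 2 * g x₀ * fderiv ℝ g x₀ w
      - (1 + (x₀ 1 : ℂ) ^ 2) * (fderiv ℝ g x₀ w * h x₀ + g x₀ * fderiv ℝ h x₀ w)
      - 2 * x₀ 1 * w 1 * (g x₀ * h x₀) + 2 * h x₀ * fderiv ℝ h x₀ w = 0 := by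
    have hc : HasFDerivAt (fun x : R6 => (x 1 : ℂ)) (ofRealCLM.comp (dc 1)) x₀ :=
      (ofRealCLM.comp (dc 1)).hasFDerivAt
    have hg' := (hgd x₀ hx₀N).hasFDerivAt
    have hh' := (hhd x₀ hx₀N).hasFDerivAt
    have hF := (((hg'.pow 2).sub (((hc.pow 2).const_add 1).mul (hg'.mul hh'))).add (hh'.pow 2))
    have hE : (fun x => g x ^ 2 - (1 + (x 1 : ℂ) ^ 2) * (g x * h x) + h x ^ 2) =ᶠ[𝓝 x₀]
        fun _ => 0 := Filter.eventually_of_mem (hN.mem_nhds hx₀N) hquad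
    have hz := hF.unique ((hasFDerivAt_const (0 : ℂ) x₀).congr_of_eventuallyEq hE)
    have := DFunLike.congr_fun hz w
    simp [dc] at this
    linear_combination this
  have q0 := hq (frame 0 x₀)
  have q1 := hq (frame 1 x₀)
  have qq := hquad x₀ hx₀N
  have hg0 : g x₀ ≠ 0 := hne x₀ hx₀N
  have hh0 : h x₀ ≠ 0 := fun hc => hg0 (by rw [hc] at qq; simpa using qq)
  have hk := hone (lam1 x₀ j)
  obtain ⟨dg0, hdg0⟩ : ∃ c, c = fderiv ℝ g x₀ (frame 0 x₀) := ⟨_, rfl⟩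
  obtain ⟨dg1, hdg1⟩ : ∃ c, c = fderiv ℝ g x₀ (frame 1 x₀) := ⟨_, rfl⟩
  obtain ⟨dh0, hdh0⟩ : ∃ c, c = fderiv ℝ h x₀ (frame 0 x₀) := ⟨_, rfl⟩
  obtain ⟨dh1, hdh1⟩ : ∃ c, c = fderiv ℝ h x₀ (frame 1 x₀) := ⟨_, rfl⟩
  rw [← hdg0, ← hdh0] at e0 q0
  rw [← hdg1, ← hdh1] at e1 q1
  simp [om1, om2, frame, dz] at e0 e1 ek q0 q1
  generalize g x₀ = G at *
  generalize h x₀ = H at *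
  generalize lam1 x₀ j = k1 at *
  generalize lam2 x₀ j = k2 at *
  set s : ℂ := 1 + (x₀ 1 : ℂ) ^ 2 with hs
  -- `A = ξ(g)` and `B = ξ(h)` for the null vector `ξ = G X₂ + (H - s G) X₁`.
  set A := G * dg1 + (H - s * G) * dg0 with hA
  set B := G * dh1 + (H - s * G) * dh0 with hB
  -- This is `dβ(Z + iJZ, ξ) = 0` with `Z = ∂_{z₁}`. The curvature terms from the `distD` part of
  -- `JZ` drop out because `ξ` is null.
  have r1 : (1 + I * k1) * A + I * k2 * B = 0 := by
    linear_combination (-G) * e1 - (H - s * G) * e0 - I * j 3 * qq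
  -- This is `β(Z + iJZ) = 0`. Together with `r1` it says that `(A, B)` is proportional to `(G, H)`,
  -- that is, `ξ(h/g) = 0`.
  have r2 : (1 + I * k1) * G + I * k2 * H = 0 := by
    linear_combination I * ek + G * I_mul_I
  have r3 : H * A - G * B = 0 := by
    refine (mul_eq_zero.1 ?_).resolve_left hk
    linear_combination H * r1 - B * r2
  -- The derivative of the quadratic relation along `ξ`; the right side is the contribution of
  -- `ξ(x₂) = G`.
  have r4 : 2 * G * A - s * (H * A + G * B) + 2 * H * B = 2 * x₀ 1 * (G * G * H) := by
    linear_combination G * q1 + (H - s * G) * q0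
  have r5 : (x₀ 1 : ℂ) * (G ^ 3 * H) = 0 := by
    linear_combination (-1 / 2) * G * r4 + A * qq - (-s * G + 2 * H) / 2 * r3
  simp [hx₀, hg0, hh0] at r5

/-- The obstruction needs `x₂ ≠ 0`; density lets it reach germs at points of `x₂ = 0` as well. -/
theorem exists_mem_coord_ne_zero {U : Set R6} (hU : IsOpen U) (hne : U.Nonempty) :
    ∃ x ∈ U, x 1 ≠ 0 := by
  have hd : Dense ((fun x : R6 => x 1) ⁻¹' {0}ᶜ) :=
    (dense_compl_singleton (0 : ℝ)).preimage (isOpenMap_eval 1)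
  obtain ⟨x, hx, hx'⟩ := hd.inter_open_nonempty U hU hne
  exact ⟨x, hx, hx'⟩

open Complex in
/-- A complex form vanishing on `V` and `J`-linear, evaluated on `[w, V] + J [Jw, V]` for
constant `w`. -/
theorem extDer_add_of_bracket {β : R6 → (R6 →L[ℝ] ℂ)} {J : R6 → (R6 →L[ℝ] R6)} {U : Set R6}
    (hU : IsOpen U) {x : R6} (hx : x ∈ U) (hβ : DifferentiableAt ℝ β x)
    (hJd : DifferentiableAt ℝ J x) {u V : R6 → R6} (hu : DifferentiableAt ℝ u x)
    (hV : DifferentiableAt ℝ V x)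
    (hJ : ∀ y ∈ U, ∀ w, β y (J y w) = I * β y w) (hβV : ∀ y ∈ U, β y (V y) = 0) :
    β x (bracket u V x + J x (bracket (applyJ J u) V x))
      = -(extDer β x (u x) (V x) + I * extDer β x (J x (u x)) (V x)) := by
  have h1 : fderiv ℝ (fun y => β y (V y)) x = 0 := by
    have : (fun y => β y (V y)) =ᶠ[𝓝 x] fun _ => 0 :=
      Filter.eventually_of_mem (hU.mem_nhds hx) hβV
    rw [this.fderiv_eq]; simp
  have h2 : fderiv ℝ (fun y => β y (applyJ J u y)) x = I • fderiv ℝ (fun y => β y (u y)) x := by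
    have : (fun y => β y (applyJ J u y)) =ᶠ[𝓝 x] fun y => I * β y (u y) :=
      Filter.eventually_of_mem (hU.mem_nhds hx) fun y hy => hJ y hy (u y)
    rw [this.fderiv_eq]
    exact fderiv_const_mul (hβ.clm_apply hu) I
  have hJu : DifferentiableAt ℝ (applyJ J u) x := hJd.clm_apply hu
  -- In Cartan's formula for the two brackets, the derivatives of `β(u)` along `V` enter with total
  -- factor `1 + i² = 0`.
  rw [map_add, hJ x hx, apply_bracket hβ hu hV, apply_bracket hβ hJu hV, h1]
  have h2' := DFunLike.congr_fun h2 (V x)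
  simp only [smul_apply, smul_eq_mul] at h2'
  rw [h2']
  simp only [zero_apply, applyJ]
  linear_combination (-fderiv ℝ (fun y => β y (u y)) x (V x)) * I_mul_I

open Complex in
theorem tensorSNonzeroOn_of_isCapEastwood {o : Orientation ℝ R6 (Fin 6)} {U : Set R6}
    (hU : IsOpen U) (hne : U.Nonempty) {J : R6 → (R6 →L[ℝ] R6)}
    (hJ : IsCapEastwood o distD U J) : TensorSNonzeroOn distD J U := by
  by_contra hS
  have hS' (u v) (hu : IsVectorFieldOn U u) (hv : IsSectionOn distD U v) (x) (hx : x ∈ U) :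
      bracket u v x + J x (bracket (applyJ J u) v x) ∈ distD x := by
    by_contra h
    refine hS ⟨u, v, hu, hv, x, hx, fun h' => h ?_⟩
    rwa [tensorS, Submodule.mkQ_apply, Submodule.Quotient.mk_eq_zero] at h'
  obtain ⟨x₀, hx₀U, hx₀⟩ := exists_mem_coord_ne_zero hU hne
  have hJd (x) (hx : x ∈ U) : DifferentiableAt ℝ J x :=
    (hJ.smooth.contDiffAt (hU.mem_nhds hx)).differentiableAt (by simp)
  have hJD (x) (hx : x ∈ U) (v) (hv : v ∈ distD x) : J x v ∈ distD x := by
    rw [← hJ.map_eq x hx]; exact ⟨v, hv, rfl⟩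
  -- Twice the `(1, 0)` part of `λ₁`; the sign gives `β ∘ J = iβ`.
  set β : R6 → (R6 →L[ℝ] ℂ) := fun y =>
    ofRealCLM.comp (lam1 y) - I • ofRealCLM.comp ((lam1 y).comp (J y)) with hβ
  have hβa (y w : R6) : β y w = lam1 y w - I * lam1 y (J y w) := by simp [hβ]
  have hβd (x) (hx : x ∈ U) : DifferentiableAt ℝ β x := by
    have hl : DifferentiableAt ℝ lam1 x := contDiff_lam1.differentiable (by simp) x
    exact ((differentiableAt_const _).clm_comp hl).sub
      (((differentiableAt_const _).clm_comp (hl.clm_comp (hJd x hx))).const_smul I)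
  have hβJ (x) (hx : x ∈ U) (w) : β x (J x w) = I * β x w := by
    rw [hβa, hβa, hJ.sq x hx, map_neg, ofReal_neg]
    linear_combination (lam1 x (J x w) : ℂ) * I_mul_I
  have hβ0 (x) (hx : x ∈ U) (v) (hv : v ∈ distD x) : β x v = 0 := by
    rw [hβa, (mem_distD.1 hv).1, (mem_distD.1 (hJD x hx v hv)).1]; simp
  refine false_of_complex_form hx₀ hU hx₀U (J := fun x w => J x w) hβd hJD hβJ hβ0 ?_ ?_
  · intro x _ hc
    rw [hβa] at hc
    generalize lam1 x (J x (dz 0 x)) = c at hc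
    have : lam1 x (dz 0 x) = 0 := by simpa using congrArg re hc
    simp [lam1_apply, dz] at this
  · intro x hx w v hv
    -- The vector `v` extended to a section of `distD` with constant frame coefficients.
    set V : R6 → R6 := fun y =>
      v 0 • frame 0 y + v 1 • frame 1 y + v 2 • frame 2 y + v 3 • frame 3 y with hV
    have hf (i : Fin 4) (c : ℝ) : ContDiff ℝ ∞ (fun y => c • frame i y) :=
      (contDiff_frame i).const_smul c
    have hVs : ContDiff ℝ ∞ V := (((hf 0 _).add (hf 1 _)).add (hf 2 _)).add (hf 3 _)
    have hVD (y) : V y ∈ distD y :=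
      add_mem (add_mem (add_mem (Submodule.smul_mem _ _ (frame_mem _ _))
        (Submodule.smul_mem _ _ (frame_mem _ _))) (Submodule.smul_mem _ _ (frame_mem _ _)))
        (Submodule.smul_mem _ _ (frame_mem _ _))
    have hVx : V x = v := (eq_sum_frame hv).symm
    have h1 := hβ0 x hx _ (hS' (fun _ => w) V contDiffOn_const
      ⟨hVs.contDiffOn, fun y _ => hVD y⟩ x hx)
    rw [extDer_add_of_bracket hU hx (hβd x hx) (hJd x hx) (differentiableAt_const _)
      (hVs.differentiable (by simp) x) hβJ (fun y hy => hβ0 y hy _ (hVD y)), hVx] at h1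
    exact neg_eq_zero.1 h1

/-! ### Complex contact structures -/

section

variable {E F : Type*} [NormedAddCommGroup E] [NormedSpace ℝ E] [NormedAddCommGroup F]
  [NormedSpace ℝ F]

theorem fderiv_symm_fderiv (e : OpenPartialHomeomorph E F) (h1 : ContDiffOn ℝ ∞ e e.source)
    (h2 : ContDiffOn ℝ ∞ e.symm e.target) {x : E} (hx : x ∈ e.source) (w : E) :
    fderiv ℝ e.symm (e x) (fderiv ℝ e x w) = w := by
  have d1 := (h1.contDiffAt (e.open_source.mem_nhds hx)).differentiableAt (by simp)
  have d2 := (h2.contDiffAt (e.open_target.mem_nhds (e.map_source hx))).differentiableAt (by simp)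
  have hc := d2.hasFDerivAt.comp x d1.hasFDerivAt
  have hi : (e.symm ∘ e) =ᶠ[𝓝 x] id :=
    Filter.eventually_of_mem (e.open_source.mem_nhds hx) fun y hy => e.left_inv hy
  exact DFunLike.congr_fun (hc.unique ((hasFDerivAt_id x).congr_of_eventuallyEq hi)) w

theorem fderiv_fderiv_symm (e : OpenPartialHomeomorph E F) (h1 : ContDiffOn ℝ ∞ e e.source)
    (h2 : ContDiffOn ℝ ∞ e.symm e.target) {x : E} (hx : x ∈ e.source) (z : F) :
    fderiv ℝ e x (fderiv ℝ e.symm (e x) z) = z := by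
  have := fderiv_symm_fderiv e.symm h2 (by simpa using h1) (e.map_source hx) z
  simpa [e.left_inv hx] using this

end

theorem SupportsComplexContact.of_areDiffeomorphicGerms {D D' : PlaneField} {q q' : R6}
    (h : AreDiffeomorphicGerms D q D' q') (h' : SupportsComplexContact D' q') :
    SupportsComplexContact D q := by
  obtain ⟨φ, hq, rfl, hφ, hφ', hD⟩ := h
  obtain ⟨Φ, α, hq', hΦ, hΦ', ⟨hα, hα'⟩, hker⟩ := h'
  refine ⟨φ.trans Φ, α, ?_, ?_, ?_, ⟨hα.mono fun p hp => ?_, fun p hp => hα' p ?_⟩, ?_⟩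
  · simpa using ⟨hq, hq'⟩
  · rw [OpenPartialHomeomorph.coe_trans]
    exact hΦ.comp (hφ.mono fun y hy => (by simp at hy; exact hy.1))
      fun y hy => (by simp at hy; exact hy.2)
  · rw [OpenPartialHomeomorph.coe_trans_symm]
    exact hφ'.comp (hΦ'.mono fun y hy => (by simp at hy; exact hy.1))
      fun y hy => (by simp at hy; exact hy.2)
  · simp at hp; exact hp.1
  · simp at hp; exact hp.1
  · intro y hy v
    have hy1 : y ∈ φ.source := by simp at hy; exact hy.1
    have hy2 : φ y ∈ Φ.source := by simp at hy; exact hy.2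
    have d1 := (hφ.contDiffAt (φ.open_source.mem_nhds hy1)).differentiableAt (by simp)
    have d2 := (hΦ.contDiffAt (Φ.open_source.mem_nhds hy2)).differentiableAt (by simp)
    rw [OpenPartialHomeomorph.coe_trans, fderiv_comp y d2 d1]
    have key : v ∈ D y ↔ fderiv ℝ φ y v ∈ D' (φ y) := by
      rw [← hD y hy1]
      refine ⟨fun hv => ⟨v, hv, rfl⟩, ?_⟩
      rintro ⟨w, hw, hwv⟩
      have := congrArg (fderiv ℝ φ.symm (φ y)) hwv
      erw [fderiv_symm_fderiv φ hφ hφ' hy1, fderiv_symm_fderiv φ hφ hφ' hy1] at this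
      rwa [← this]
    rw [key, hker _ hy2]
    rfl

open Complex in
theorem not_supportsComplexContact_distD (q : R6) : ¬ SupportsComplexContact distD q := by
  rintro ⟨Φ, α, hq, hΦ, hΦ', ⟨hα, -⟩, hker⟩
  obtain ⟨x₀, hx₀, hne⟩ := exists_mem_coord_ne_zero Φ.open_source ⟨q, hq⟩
  set A : C3 → (C3 →L[ℝ] ℂ) := fun p => ContinuousLinearMap.restrictScalarsL ℂ C3 ℂ ℝ ℝ (α p)
    with hA
  have hAd (p) (hp : p ∈ Φ.target) : HasFDerivAt A
      ((ContinuousLinearMap.restrictScalarsL ℂ C3 ℂ ℝ ℝ).comp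
        ((fderiv ℂ α p).restrictScalars ℝ)) p :=
    (ContinuousLinearMap.restrictScalarsL ℂ C3 ℂ ℝ ℝ).hasFDerivAt.comp p
      ((hα.differentiableAt (Φ.open_target.mem_nhds hp)).hasFDerivAt.restrictScalars ℝ)
  set β : R6 → (R6 →L[ℝ] ℂ) := fun x => (A (Φ x)).comp (fderiv ℝ Φ x) with hβ
  have hs (x) (hx : x ∈ Φ.source) : ContDiffAt ℝ ∞ Φ x :=
    hΦ.contDiffAt (Φ.open_source.mem_nhds hx)
  have hβd (x) (hx : x ∈ Φ.source) := ((hAd _ (Φ.map_source hx)).comp x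
      ((hs x hx).differentiableAt (by simp)).hasFDerivAt).clm_comp
      (((hs x hx).fderiv_right (m := 1) (WithTop.coe_le_coe.2 (le_top (a := (2 : ℕ∞))))).differentiableAt (by simp)).hasFDerivAt
  have hext (x) (hx : x ∈ Φ.source) (u v : R6) :
      extDer β x u v = dForm α (Φ x) (fderiv ℝ Φ x u) (fderiv ℝ Φ x v) := by
    -- Exterior differentiation commutes with pullback: the second derivatives of `Φ` cancel by
    -- symmetry.
    have hsymm : fderiv ℝ (fderiv ℝ Φ) x u v = fderiv ℝ (fderiv ℝ Φ) x v u :=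
      ((hs x hx).isSymmSndFDerivAt (by simpa using ENat.LEInfty.out)) u v
    have hd (u v : R6) : fderiv ℝ β x u v = fderiv ℂ α (Φ x) (fderiv ℝ Φ x u) (fderiv ℝ Φ x v)
        + α (Φ x) (fderiv ℝ (fderiv ℝ Φ) x u v) := by
      erw [(hβd x hx).fderiv]
      simp [hA, add_comm]
    rw [extDer, hd, hd, dForm, hsymm]
    ring
  have hJ (x) (hx : x ∈ Φ.source) (z : C3) := fderiv_fderiv_symm Φ hΦ hΦ' hx z
  have hβa (x w : R6) : β x w = α (Φ x) (fderiv ℝ Φ x w) := rfl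
  have hβJ (x) (hx : x ∈ Φ.source) (w : R6) :
      β x (fderiv ℝ Φ.symm (Φ x) (I • fderiv ℝ Φ x w)) = I * β x w := by
    rw [hβa, hJ x hx, map_smul, hβa, smul_eq_mul]
  refine false_of_complex_form hne Φ.open_source hx₀ (β := β)
    (J := fun x w => fderiv ℝ Φ.symm (Φ x) (I • fderiv ℝ Φ x w))
    (fun x hx => (hβd x hx).differentiableAt) ?_ hβJ (fun x hx v hv => (hker x hx v).1 hv) ?_ ?_
  · intro x hx v hv
    refine (hker x hx _).2 ((hβJ x hx v).trans ?_)
    rw [hβa, (hker x hx v).1 hv, mul_zero]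
  · intro x hx hc
    have := (mem_distD.1 ((hker x hx _).2 hc)).1
    simp [lam1_apply, dz] at this
  · intro x hx w v _
    rw [hext x hx, hext x hx, hJ x hx]
    simp only [dForm, map_smul, smul_apply, smul_eq_mul]
    -- Holomorphy of `α` makes `dα` complex bilinear, so the two terms carry the factor `1 + i²`.
    linear_combination (fderiv ℂ α (Φ x) (fderiv ℝ Φ x w) (fderiv ℝ Φ x v)
      - fderiv ℂ α (Φ x) (fderiv ℝ Φ x v) (fderiv ℝ Φ x w)) * I_mul_I

/-! ### Orientation of adapted bases -/

/-- The standard complex structure of six-space. -/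
def stdJ (v : R6) : R6 := ![-v 1, v 0, -v 3, v 2, -v 5, v 4]

/-- The identification of six-space with complex three-space. -/
def toC3 : R6 ≃ₗ[ℝ] C3 where
  toFun v := ![⟨v 0, v 1⟩, ⟨v 2, v 3⟩, ⟨v 4, v 5⟩]
  invFun z := ![(z 0).re, (z 0).im, (z 1).re, (z 1).im, (z 2).re, (z 2).im]
  map_add' u v := by ext j; fin_cases j <;> apply Complex.ext <;> simp
  map_smul' c v := by ext j; fin_cases j <;> apply Complex.ext <;> simp
  left_inv v := by ext j; fin_cases j <;> simp
  right_inv z := by ext j; fin_cases j <;> apply Complex.ext <;> simp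

/-- If `S` intertwines `J` with the standard complex structure, its determinant has the sign of
that of every family adapted to `J`. -/
theorem det_mul_det_nonneg (S : R6 →ₗ[ℝ] R6) {J : R6 → R6} (hS : ∀ w, S (J w) = stdJ (S w))
    (b : Fin 6 → R6) (h1 : b 1 = J (b 0)) (h3 : b 3 = J (b 2)) (h5 : b 5 = J (b 4)) :
    0 ≤ LinearMap.det S * (Pi.basisFun ℝ (Fin 6)).det b := by
  set f : C3 →ₗ[ℂ] C3 := Fintype.linearCombination ℂ
    ![toC3 (S (b 0)), toC3 (S (b 2)), toC3 (S (b 4))] with hf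
  set T : R6 →ₗ[ℝ] R6 := (Pi.basisFun ℝ (Fin 6)).constr ℝ b with hT
  have hdT : (Pi.basisFun ℝ (Fin 6)).det b = LinearMap.det T := by
    rw [Module.Basis.det_apply, Module.Basis.toMatrix_eq_toMatrix_constr,
      LinearMap.det_toMatrix]
    rfl
  -- An adapted family makes `T` carry `stdJ` to `J` and `S` carries it back, so `S ∘ T` is complex
  -- linear and its real determinant is `|det f|²`.
  have hcomp : S.comp T = (toC3.symm : C3 →ₗ[ℝ] R6) ∘ₗ (f.restrictScalars ℝ) ∘ₗ
      (toC3.symm.symm : R6 →ₗ[ℝ] C3) := by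
    refine LinearMap.ext fun v => toC3.injective ?_
    have e0 (w : R6) : S (J w) 0 = -S w 1 := by rw [hS]; rfl
    have e1 (w : R6) : S (J w) 1 = S w 0 := by rw [hS]; rfl
    have e2 (w : R6) : S (J w) 2 = -S w 3 := by rw [hS]; rfl
    have e3 (w : R6) : S (J w) 3 = S w 2 := by rw [hS]; rfl
    have e4 (w : R6) : S (J w) 4 = -S w 5 := by rw [hS]; rfl
    have e5 (w : R6) : S (J w) 5 = S w 4 := by rw [hS]; rfl
    simp only [LinearMap.comp_apply, hT, Module.Basis.constr_apply_fintype,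
      Fin.sum_univ_six, h1, h3, h5, hf, LinearEquiv.coe_coe, LinearEquiv.apply_symm_apply,
      LinearMap.restrictScalars_apply, Fintype.linearCombination_apply, Fin.sum_univ_three]
    ext j
    fin_cases j <;> apply Complex.ext <;> simp [toC3, e0, e1, e2, e3, e4, e5] <;> ring
  rw [hdT, ← map_mul, Module.End.mul_eq_comp, hcomp, LinearMap.det_conj,
    LinearMap.det_restrictScalars, Algebra.norm_complex_apply]
  exact Complex.normSq_nonneg _

theorem det_mul_det_pos (S : R6 →ₗ[ℝ] R6) {J : R6 → R6} (hS : ∀ w, S (J w) = stdJ (S w))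
    (hS0 : LinearMap.det S ≠ 0) (b : Module.Basis (Fin 6) ℝ R6)
    (h1 : b 1 = J (b 0)) (h3 : b 3 = J (b 2)) (h5 : b 5 = J (b 4)) :
    0 < LinearMap.det S * (Pi.basisFun ℝ (Fin 6)).det b :=
  lt_of_le_of_ne (det_mul_det_nonneg S hS b h1 h3 h5)
    (mul_ne_zero hS0 ((Pi.basisFun ℝ (Fin 6)).isUnit_det b).ne_zero).symm

/-! ### The almost complex structure -/

/-- Half of `1 + x₂²`. -/
def cfP (q : R6) : ℝ := (1 + (q 1) ^ 2) / 2

/-- `√(1 - p²)`. -/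
def cfR (q : R6) : ℝ := √(1 - (cfP q) ^ 2)

/-- `x₂ / (2 r³)`. -/
def cfM (q : R6) : ℝ := q 1 * (cfR q)⁻¹ ^ 3 / 2

/-- Here `|x₂| < 1` enters: it makes the roots `p ± i r` nonreal. -/
theorem one_sub_cfP_sq_pos {x : R6} (hx : x ∈ region) : 0 < 1 - (cfP x) ^ 2 := by
  have := sq_lt_one_of_mem hx
  have h0 := sq_nonneg (x 1)
  rw [cfP]; nlinarith

theorem cfR_pos {x : R6} (hx : x ∈ region) : 0 < cfR x := Real.sqrt_pos.2 (one_sub_cfP_sq_pos hx)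

theorem cfR_sq {x : R6} (hx : x ∈ region) : cfR x ^ 2 = 1 - cfP x ^ 2 :=
  Real.sq_sqrt (one_sub_cfP_sq_pos hx).le

theorem contDiff_cfP : ContDiff ℝ ∞ cfP :=
  (contDiff_const.add ((contDiff_coord 1).pow 2)).div_const _

theorem contDiffOn_cfR : ContDiffOn ℝ ∞ cfR region :=
  (contDiff_const.sub (contDiff_cfP.pow 2)).contDiffOn.sqrt
    fun _ hx => (one_sub_cfP_sq_pos hx).ne'

theorem contDiffOn_cfR_inv : ContDiffOn ℝ ∞ (fun x => (cfR x)⁻¹) region :=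
  contDiffOn_cfR.inv fun _ hx => (cfR_pos hx).ne'

theorem contDiffOn_cfM : ContDiffOn ℝ ∞ cfM region :=
  ((contDiff_coord 1).contDiffOn.mul (contDiffOn_cfR_inv.pow 3)).div_const _

/-- The components of the structure with respect to the coframe `dx, dy, λ`. -/
def jForm (q : R6) : Fin 6 → (R6 →L[ℝ] ℝ) :=
  ![(cfR q)⁻¹ • (cfP q • dc 0 + dc 1),
    (cfR q)⁻¹ • (-dc 0 - cfP q • dc 1),
    (cfR q)⁻¹ • (-(cfP q • dc 2) + dc 3) + cfM q • lam2 q,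
    (cfR q)⁻¹ • (cfP q • dc 3 - dc 2) - cfM q • lam1 q,
    (cfR q)⁻¹ • (-(cfP q • lam1 q) - lam2 q),
    (cfR q)⁻¹ • (lam1 q + cfP q • lam2 q)]

/-- The frame dual to `dx, dy, λ`. -/
def fullFrame (i : Fin 6) (q : R6) : R6 :=
  ![frame 0 q, frame 1 q, frame 2 q, frame 3 q, ![0, 0, 0, 0, 1, 0], ![0, 0, 0, 0, 0, 1]] i

/-- An almost complex structure adapted to `distD`. -/
def theJ (q : R6) : R6 →L[ℝ] R6 := ∑ i, (jForm q i).smulRight (fullFrame i q)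

theorem contDiff_fullFrame (i : Fin 6) : ContDiff ℝ ∞ (fullFrame i) := by
  fin_cases i
  · exact contDiff_frame 0
  · exact contDiff_frame 1
  · exact contDiff_frame 2
  · exact contDiff_frame 3
  · exact contDiff_const
  · exact contDiff_const

theorem contDiffOn_jForm (i : Fin 6) : ContDiffOn ℝ ∞ (fun q => jForm q i) region := by
  have hr := contDiffOn_cfR_inv
  have hp := contDiff_cfP.contDiffOn (s := region)
  have hm := contDiffOn_cfM
  have h1 := contDiff_lam1.contDiffOn (s := region)
  have h2 := contDiff_lam2.contDiffOn (s := region)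
  have hc (i : Fin 6) : ContDiffOn ℝ ∞ (fun _ : R6 => dc i) region := contDiffOn_const
  fin_cases i
  · exact hr.smul ((hp.smul (hc 0)).add (hc 1))
  · exact hr.smul ((hc 0).neg.sub (hp.smul (hc 1)))
  · exact (hr.smul ((hp.smul (hc 2)).neg.add (hc 3))).add (hm.smul h2)
  · exact (hr.smul ((hp.smul (hc 3)).sub (hc 2))).sub (hm.smul h1)
  · exact hr.smul ((hp.smul h1).neg.sub h2)
  · exact hr.smul (h1.add (hp.smul h2))

theorem contDiffOn_theJ : ContDiffOn ℝ ∞ theJ region :=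
  ContDiffOn.sum fun i _ => (contDiffOn_jForm i).smulRight (contDiff_fullFrame i).contDiffOn

section

variable (q v : R6)

theorem theJ_zero : theJ q v 0 = (cfR q)⁻¹ * (cfP q * v 0 + v 1) := by
  simp [theJ, Fin.sum_univ_six, jForm, fullFrame, frame, dc]
  ring

theorem theJ_one : theJ q v 1 = (cfR q)⁻¹ * (-v 0 - cfP q * v 1) := by
  simp [theJ, Fin.sum_univ_six, jForm, fullFrame, frame, dc]

theorem theJ_two : theJ q v 2 = (cfR q)⁻¹ * (-(cfP q * v 2) + v 3) + cfM q * lam2 q v := by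
  simp [theJ, Fin.sum_univ_six, jForm, fullFrame, frame, dc]
  ring

theorem theJ_three : theJ q v 3 = (cfR q)⁻¹ * (cfP q * v 3 - v 2) - cfM q * lam1 q v := by
  simp [theJ, Fin.sum_univ_six, jForm, fullFrame, frame, dc]

theorem lam1_theJ : lam1 q (theJ q v) = (cfR q)⁻¹ * (-(cfP q * lam1 q v) - lam2 q v) := by
  rw [lam1_apply]
  simp [theJ, Fin.sum_univ_six, jForm, fullFrame, frame, dc]
  ring

theorem lam2_theJ : lam2 q (theJ q v) = (cfR q)⁻¹ * (lam1 q v + cfP q * lam2 q v) := by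
  rw [lam2_apply]
  simp [theJ, Fin.sum_univ_six, jForm, fullFrame, frame, dc]
  ring

end

theorem ext_coframe {q v w : R6} (h0 : v 0 = w 0) (h1 : v 1 = w 1) (h2 : v 2 = w 2)
    (h3 : v 3 = w 3) (h4 : lam1 q v = lam1 q w) (h5 : lam2 q v = lam2 q w) : v = w := by
  rw [lam1_apply, lam1_apply] at h4
  rw [lam2_apply, lam2_apply] at h5
  ext j
  fin_cases j
  · exact h0
  · exact h1
  · exact h2
  · exact h3
  · simp only [h0, h1, h2] at h4; simp; linarith
  · simp only [h0, h1] at h5; simp; linarith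

theorem theJ_theJ {q : R6} (hq : q ∈ region) (v : R6) : theJ q (theJ q v) = -v := by
  have hr := (cfR_pos hq).ne'
  have hr2 := cfR_sq hq
  have hi : (cfR q)⁻¹ ^ 2 * (1 - cfP q ^ 2) = 1 := by rw [← hr2]; field_simp
  apply ext_coframe (q := q) <;>
    simp only [theJ_zero, theJ_one, theJ_two, theJ_three, lam1_theJ, lam2_theJ, map_neg,
      Pi.neg_apply]
  · linear_combination (-v 0) * hi
  · linear_combination (-v 1) * hi
  · linear_combination (-v 2) * hi
  · linear_combination (-v 3) * hi
  · linear_combination (-lam1 q v) * hi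
  · linear_combination (-lam2 q v) * hi

theorem theJ_mem {q v : R6} (hv : v ∈ distD q) : theJ q v ∈ distD q := by
  obtain ⟨h1, h2⟩ := mem_distD.1 hv
  rw [mem_distD, lam1_theJ, lam2_theJ, h1, h2]; simp

/-- The intertwining map of `theJ` with the standard complex structure. -/
def toStd (q : R6) : R6 →ₗ[ℝ] R6 :=
  Matrix.toLin' !![1, cfP q, 0, 0, 0, 0;
    0, -cfR q, 0, 0, 0, 0;
    0, 0, 1, -cfP q, cfM q * cfR q / 2, 0;
    0, 0, 0, -cfR q, -(cfM q * cfP q / 2), -(cfM q / 2);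
    0, 0, 0, 0, 1, cfP q;
    0, 0, 0, 0, 0, cfR q] ∘ₗ
  Matrix.toLin' !![1, 0, 0, 0, 0, 0;
    0, 1, 0, 0, 0, 0;
    0, 0, 1, 0, 0, 0;
    0, 0, 0, 1, 0, 0;
    -q 2, -q 3, -((q 1) ^ 3 / 3 + q 1 + 2 * q 0), 0, 1, 0;
    -q 3, -q 2, 0, 0, 0, 1]

/-- The pairs are real and imaginary parts of the `(1, 0)` forms `dx₁ + τ̄ dx₂`, `dy₁ - τ dy₂ +
(m/2)(r λ₁ - i(p λ₁ + λ₂))` and `λ₁ + τ λ₂`. -/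
theorem toStd_apply (q v : R6) : toStd q v =
    ![v 0 + cfP q * v 1, -(cfR q * v 1), v 2 - cfP q * v 3 + cfM q * cfR q / 2 * lam1 q v,
      -(cfR q * v 3) - cfM q * cfP q / 2 * lam1 q v - cfM q / 2 * lam2 q v,
      lam1 q v + cfP q * lam2 q v, cfR q * lam2 q v] := by
  ext j
  fin_cases j <;>
    simp [-mul_eq_mul_left_iff, toStd, Matrix.mulVec, dotProduct, Fin.sum_univ_six, lam1_apply, lam2_apply] <;> ring

theorem det_toStd (q : R6) : LinearMap.det (toStd q) = cfR q ^ 3 := by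
  rw [toStd, LinearMap.det_comp, LinearMap.det_toLin', LinearMap.det_toLin',
    Matrix.det_of_isUpperTriangular, Matrix.det_of_isLowerTriangular]
  · simp [Fin.prod_univ_six]; ring
  · intro i j (hij : i < j)
    revert hij
    fin_cases i <;> fin_cases j <;> simp
  · intro i j (hij : j < i)
    revert hij
    fin_cases i <;> fin_cases j <;> simp

theorem toStd_theJ {q : R6} (hq : q ∈ region) (v : R6) :
    toStd q (theJ q v) = stdJ (toStd q v) := by
  have hr := (cfR_pos hq).ne'
  have hr2 := cfR_sq hq
  have hi : (cfR q)⁻¹ * cfR q = 1 := by field_simp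
  rw [toStd_apply, toStd_apply]
  ext j
  fin_cases j <;>
    simp [stdJ, theJ_zero, theJ_one, theJ_two, theJ_three, lam1_theJ, lam2_theJ] <;> grind

/-! ### The `(1, 0)` form `λ₁ + τ λ₂` and the axioms for `theJ` -/

section

open Complex

/-- The complex root `p + i r` of `τ² - (1 + x₂²) τ + 1`. -/
def tau (q : R6) : ℂ := cfP q + cfR q * I

/-- The form `λ₁ + τ λ₂` of type `(1, 0)`. -/
def lamC (q : R6) : R6 →L[ℝ] ℂ := ofRealCLM.comp (lam1 q) + tau q • ofRealCLM.comp (lam2 q)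

theorem lamC_apply (q v : R6) : lamC q v = lam1 q v + tau q * lam2 q v := by
  simp [lamC]

theorem hasFDerivAt_cfP (x : R6) : HasFDerivAt cfP (x 1 • dc 1) x := by
  have h : HasFDerivAt (fun q : R6 => q 1) (dc 1) x := hasFDerivAt_apply 1 x
  refine (((h.pow 2).const_add 1).mul_const (2 : ℝ)⁻¹).congr_fderiv ?_
  ext v
  simp [dc]
  ring

theorem hasFDerivAt_cfR {x : R6} (hx : x ∈ region) :
    HasFDerivAt cfR (-((cfR x)⁻¹ * cfP x * x 1) • dc 1) x := by
  refine ((((hasFDerivAt_cfP x).pow 2).const_sub 1).sqrt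
    (one_sub_cfP_sq_pos hx).ne').congr_fderiv ?_
  ext v
  have : √(1 - cfP x ^ 2) = cfR x := rfl
  simp [dc, this]
  ring

theorem hasFDerivAt_tau {x : R6} (hx : x ∈ region) :
    HasFDerivAt tau ((x 1 * (1 - (cfR x)⁻¹ * cfP x * I) : ℂ) • ofRealCLM.comp (dc 1)) x := by
  have h1 := (ofRealCLM.hasFDerivAt (x := cfP x)).comp x (hasFDerivAt_cfP x)
  have h2 := (ofRealCLM.hasFDerivAt (x := cfR x)).comp x (hasFDerivAt_cfR hx)
  refine (h1.add (h2.mul_const I)).congr_fderiv ?_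
  ext v
  simp [dc]
  ring

theorem differentiableAt_lamC {x : R6} (hx : x ∈ region) : DifferentiableAt ℝ lamC x :=
  ((differentiableAt_const _).clm_comp (contDiff_lam1.differentiable (by simp) x)).add
    ((hasFDerivAt_tau hx).differentiableAt.smul
      ((differentiableAt_const _).clm_comp (contDiff_lam2.differentiable (by simp) x)))

theorem fderiv_lamC {x : R6} (hx : x ∈ region) (u v : R6) : fderiv ℝ lamC x u v =
    fderiv ℝ lam1 x u v + tau x * fderiv ℝ lam2 x u v
      + x 1 * (1 - (cfR x)⁻¹ * cfP x * I) * u 1 * lam2 x v := by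
  have d1 := contDiff_lam1.differentiable (by simp) x
  have d2 := contDiff_lam2.differentiable (by simp) x
  have h1 : HasFDerivAt (fun y => (lam1 y v : ℂ)) _ x :=
    ofRealCLM.hasFDerivAt.comp x (d1.clm_apply (differentiableAt_const v)).hasFDerivAt
  have h2 : HasFDerivAt (fun y => (lam2 y v : ℂ)) _ x :=
    ofRealCLM.hasFDerivAt.comp x (d2.clm_apply (differentiableAt_const v)).hasFDerivAt
  have hF := h1.add ((hasFDerivAt_tau hx).mul h2)
  rw [fderiv_apply_const (differentiableAt_lamC hx),
    (hF.congr_of_eventuallyEq (.of_forall fun y => lamC_apply y v)).fderiv,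
    fderiv_apply_const d1, fderiv_apply_const d2]
  simp [dc]
  ring

theorem extDer_lamC {x : R6} (hx : x ∈ region) (u : R6) {v : R6} (hv : v ∈ distD x) :
    extDer lamC x u v = om1 x u v + tau x * om2 u v
      - x 1 * (1 - (cfR x)⁻¹ * cfP x * I) * v 1 * lam2 x u := by
  rw [← extDer_lam1, ← extDer_lam2]
  simp only [extDer, fderiv_lamC hx, (mem_distD.1 hv).2]
  push_cast
  ring

theorem lamC_theJ {x : R6} (hx : x ∈ region) (w : R6) :
    lamC x (theJ x w) = I * lamC x w := by
  have hr := (cfR_pos hx).ne'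
  have hr2 := cfR_sq hx
  rw [lamC_apply, lamC_apply, lam1_theJ, lam2_theJ, tau]
  apply Complex.ext <;> simp <;> grind

theorem lamC_eq_zero_iff {x : R6} (hx : x ∈ region) {w : R6} :
    lamC x w = 0 ↔ w ∈ distD x := by
  have hr := (cfR_pos hx).ne'
  rw [lamC_apply, mem_distD, tau, Complex.ext_iff]
  simp [hr]
  intro h
  simp [h]

/-- On `distD` the `dτ` term vanishes, and the vectors `u + iJu` are null for the degenerate form
`dλ₁ + τ dλ₂`. -/
theorem extDer_lamC_curvature {x : R6} (hx : x ∈ region) {u v : R6} (hu : u ∈ distD x)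
    (hv : v ∈ distD x) :
    extDer lamC x u v + I * extDer lamC x (theJ x u) v = 0 := by
  have hr := (cfR_pos hx).ne'
  have hr2 := cfR_sq hx
  have hp : 1 + (x 1) ^ 2 = 2 * cfP x := by rw [cfP]; ring
  obtain ⟨h1, h2⟩ := mem_distD.1 hu
  rw [extDer_lamC hx u hv, extDer_lamC hx _ hv, (mem_distD.1 (theJ_mem hu)).2]
  simp only [om1, om2, hp, tau, theJ_zero, theJ_one, theJ_two, theJ_three, h1, h2]
  apply Complex.ext <;> simp <;> grind

/-- This says that `S(u, v)` is conjugate linear in `v`. For `u` transverse to `distD` the term `dτ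
∧ λ₂` has a complex linear part in `v`; the correction `cfM`, which gives `J∂_{zᵢ}` a component in
`distD`, is chosen to cancel it. -/
theorem extDer_lamC_compat {x : R6} (hx : x ∈ region) (u : R6) {v : R6} (hv : v ∈ distD x) :
    extDer lamC x u v + I * extDer lamC x (theJ x u) v
      = I * (extDer lamC x u (theJ x v) + I * extDer lamC x (theJ x u) (theJ x v)) := by
  have hr := (cfR_pos hx).ne'
  have hr2 := cfR_sq hx
  have hp : 1 + (x 1) ^ 2 = 2 * cfP x := by rw [cfP]; ring
  have hm : cfM x = x 1 * (cfR x)⁻¹ ^ 3 / 2 := rfl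
  obtain ⟨h1, h2⟩ := mem_distD.1 hv
  rw [extDer_lamC hx u hv, extDer_lamC hx _ hv, extDer_lamC hx u (theJ_mem hv),
    extDer_lamC hx _ (theJ_mem hv)]
  simp only [om1, om2, hp, tau, theJ_zero, theJ_one, theJ_two, theJ_three, lam2_theJ,
    h1, h2]
  apply Complex.ext <;> simp <;> grind

theorem isSectionOn_applyJ {v : R6 → R6} (hv : IsSectionOn distD region v) :
    IsSectionOn distD region (applyJ theJ v) :=
  ⟨contDiffOn_theJ.clm_apply hv.1, fun x hx => theJ_mem (hv.2 x hx)⟩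

theorem lamC_tensor {u v : R6 → R6} (hu : IsVectorFieldOn region u)
    (hv : IsSectionOn distD region v) {x : R6} (hx : x ∈ region) :
    lamC x (bracket u v x + theJ x (bracket (applyJ theJ u) v x))
      = -(extDer lamC x (u x) (v x) + I * extDer lamC x (theJ x (u x)) (v x)) := by
  have hd {f : R6 → R6} (hf : ContDiffOn ℝ ∞ f region) : DifferentiableAt ℝ f x :=
    (hf.contDiffAt (isOpen_region.mem_nhds hx)).differentiableAt (by simp)
  exact extDer_add_of_bracket isOpen_region hx (differentiableAt_lamC hx)
    ((contDiffOn_theJ.contDiffAt (isOpen_region.mem_nhds hx)).differentiableAt (by simp))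
    (hd hu) (hd hv.1) (fun y hy w => lamC_theJ hy w)
    fun y hy => (lamC_eq_zero_iff hy).2 (hv.2 y hy)

theorem isCapEastwood_theJ :
    IsCapEastwood (Pi.basisFun ℝ (Fin 6)).orientation distD region theJ where
  smooth := contDiffOn_theJ
  sq _ hx v := theJ_theJ hx v
  map_eq x hx := by
    apply le_antisymm
    · rintro _ ⟨v, hv, rfl⟩
      exact theJ_mem hv
    · intro v hv
      exact ⟨-theJ x v, neg_mem (theJ_mem hv), by simp [theJ_theJ hx]⟩
  orientation x hx b h1 h3 h5 := by
    have hr := pow_pos (cfR_pos hx) 3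
    have h := det_mul_det_pos (toStd x) (fun w => toStd_theJ hx w)
      (by rw [det_toStd]; exact hr.ne') b h1 h3 h5
    rw [det_toStd] at h
    exact ((Module.Basis.orientation_eq_iff_det_pos _ _).2 (pos_of_mul_pos_right h hr.le)).symm
  curvature u v hu hv x hx := by
    rw [← lamC_eq_zero_iff hx, lamC_tensor hu.1 hv hx,
      extDer_lamC_curvature hx (hu.2 x hx) (hv.2 x hx), neg_zero]
  compat u v hu hv x hx := by
    have h1 := lamC_tensor hu hv hx
    have h2 := lamC_tensor hu (isSectionOn_applyJ hv) hx
    have h3 := extDer_lamC_compat hx (u x) (hv.2 x hx)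
    rw [← lamC_eq_zero_iff hx, map_add, map_sub, lamC_theJ hx (bracket u _ x)]
    rw [map_add, lamC_theJ hx] at h2
    have e : applyJ theJ v x = theJ x (v x) := rfl
    rw [e] at h2
    linear_combination h1 - I * h2 - h3
      + lamC x (bracket (applyJ theJ u) (applyJ theJ v) x) * I_mul_I

/-! ### Reversing the orientation -/

theorem bracket_neg_left (u v : R6 → R6) (x : R6) :
    bracket (fun y => -u y) v x = -bracket u v x := by
  simp [bracket, VectorField.lieBracket, fderiv_fun_neg]
  abel

theorem bracket_neg_right (u v : R6 → R6) (x : R6) :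
    bracket u (fun y => -v y) x = -bracket u v x := by
  simp [bracket, VectorField.lieBracket, fderiv_fun_neg]
  abel

theorem IsCapEastwood.neg {o : Orientation ℝ R6 (Fin 6)} {D : PlaneField} {U : Set R6}
    {J : R6 → (R6 →L[ℝ] R6)} (h : IsCapEastwood o D U J) :
    IsCapEastwood (-o) D U (fun x => -J x) where
  smooth := h.smooth.neg
  sq x hx v := by simp [h.sq x hx]
  map_eq x hx := by
    nth_rewrite 2 [← h.map_eq x hx]
    ext w
    constructor
    · rintro ⟨v, hv, rfl⟩
      exact ⟨-v, neg_mem hv, by simp⟩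
    · rintro ⟨v, hv, rfl⟩
      exact ⟨-v, neg_mem hv, by simp⟩
  orientation x hx b h1 h3 h5 := by
    -- Negating the three vectors `b 1, b 3, b 5` turns a basis adapted to `-J` into one adapted to
    -- `J`; three being odd, the orientation flips.
    have := h.orientation x hx (b.unitsSMul (![1, -1, 1, -1, 1, -1] : Fin 6 → ℝˣ))
      (by simp [Module.Basis.unitsSMul_apply, h1]) (by simp [Module.Basis.unitsSMul_apply, h3])
      (by simp [Module.Basis.unitsSMul_apply, h5])
    rw [Module.Basis.orientation_unitsSMul] at this
    simp [Fin.prod_univ_six] at this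
    rw [← this, Module.Ray.neg_units_smul, one_smul]
    exact (neg_neg b.orientation).symm
  curvature u v hu hv x hx := by
    have := h.curvature u v hu hv x hx
    have e : applyJ (fun x => -J x) u = fun y => -applyJ J u y := rfl
    rw [e, bracket_neg_left]
    simpa using this
  compat u v hu hv x hx := by
    have := h.compat u v hu hv x hx
    have e (u) : applyJ (fun x => -J x) u = fun y => -applyJ J u y := rfl
    simp only [e, bracket_neg_left, bracket_neg_right]
    simpa using this

theorem exists_isCapEastwood (o : Orientation ℝ R6 (Fin 6)) :
    ∃ J : R6 → (R6 →L[ℝ] R6), IsCapEastwood o distD region J := by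
  rcases (Pi.basisFun ℝ (Fin 6)).orientation_eq_or_eq_neg o with rfl | rfl
  · exact ⟨_, isCapEastwood_theJ⟩
  · exact ⟨_, isCapEastwood_theJ.neg⟩

end

end FatContact

end

theorem mainTheorem3 :
    (∀ q ∈ FatContact.region,
      FatContact.IsFatGerm FatContact.distD q ∧
      FatContact.AreReebDirectionsAt FatContact.distD q FatContact.dz ∧
      ∀ (D' : FatContact.PlaneField) (q' : FatContact.R6),
        FatContact.AreDiffeomorphicGerms FatContact.distD q D' q' →
          ¬ FatContact.SupportsComplexContact D' q') ∧
    (∀ o : Orientation ℝ FatContact.R6 (Fin 6),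
      (∃ J : FatContact.R6 → (FatContact.R6 →L[ℝ] FatContact.R6),
        FatContact.IsCapEastwood o FatContact.distD FatContact.region J) ∧
      ∀ U : Set FatContact.R6, IsOpen U → U.Nonempty → U ⊆ FatContact.region →
        ∀ J : FatContact.R6 → (FatContact.R6 →L[ℝ] FatContact.R6),
          FatContact.IsCapEastwood o FatContact.distD U J →
            FatContact.TensorSNonzeroOn FatContact.distD J U) :=
  ⟨fun q hq => ⟨FatContact.isFatGerm_distD hq, FatContact.areReebDirectionsAt_distD q,
    fun _ _ h h' => FatContact.not_supportsComplexContact_distD q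
      (FatContact.SupportsComplexContact.of_areDiffeomorphicGerms h h')⟩,
    fun o => ⟨FatContact.exists_isCapEastwood o, fun _ hU hne _ _ hJ =>
      FatContact.tensorSNonzeroOn_of_isCapEastwood hU hne hJ⟩⟩
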